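/- Let $\rho\neq\sigma$ be two density matrices (complex, positive semidefinite, trace one) on a finite-dimensional Hilbert space, with the same eigenvalues counted with multiplicity. Let $\|\cdot\|$ be the operator norm, $D_{\mathrm{Tr}}(\rho,\sigma)=\frac12\|\rho-\sigma\|_1=\frac12\operatorname{tr}\sqrt{(\rho-\sigma)^\dagger(\rho-\sigma)}$ the trace distance and $F=\operatorname{tr}\sqrt{\sqrt\rho\,\sigma\sqrt\rho}$ the fidelity. An integrable family of Hermitian matrices $(V_t)_{0\le t\le T}$ *drives $\rho$ to $\sigma$ in time $T\geq 0$* if $U\rho U^\dagger=\sigma$ for the time-ordered exponential $U=\mathrm{Texp}\left(-i\int_0^T V_t\,dt\right)$. The quantum charging distance $D(\rho,\sigma)$ is the infimum of the times $T$ in which some $(V_t)$ with $\|V_t\|=1$ for all $t$ drives $\rho$ to $\sigma$. Then $D(\rho,\sigma)>0$, and the following hold. 1. Let $H$ be a Hermitian matrix, let $(V_t)_{0\le t\le T}$ drive $\rho$ to $\sigma$ in time $T$, and let $v$ be a real number with $\|V_t\|\le v$ for all $t\in[0,T]$. Then $T>0$, and the mean charging power $P=|\operatorname{tr}(H\rho)-\operatorname{tr}(H\sigma)|/T$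 satisfies $$P\le 2\|H\|\,v\,\frac{D_{\mathrm{Tr}}(\rho,\sigma)}{D(\rho,\sigma)}\le 2\|H\|\,v .$$ 2. The first bound is attained: for all $h\ge0$ and $v>0$ there are a Hermitian $H$ with $\|H\|=h$, a time $T$ and a family $(V_t)_{0\le t\le T}$ with $\|V_t\|=v$ for all $t$ that drives $\rho$ to $\sigma$ in time $T$, such that $P=2hv\,D_{\mathrm{Tr}}(\rho,\sigma)/D(\rho,\sigma)$. 3. $\arccos F>0$ and $$\frac{D_{\mathrm{Tr}}(\rho,\sigma)}{D(\rho,\sigma)}\le\frac{\sqrt{1-F^2}}{\arccos F}<1 .$$ -/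

import Mathlib

open scoped Matrix Matrix.Norms.L2Operator MatrixOrder ComplexOrder
open MeasureTheory Set

namespace QuantumCharging

noncomputable section

/-- Density matrices: positive semidefinite with unit trace. -/
def IsDensityMatrix {n : Type*} [Fintype n] (ρ : Matrix n n ℂ) : Prop :=
  ρ.PosSemidef ∧ ρ.trace = 1

/-- `U t = Texp (-i ∫₀ᵗ V_s ds)` for `t ∈ [0, T]`: the propagator `U` is the continuous solution of
`U' = -i V U`, `U 0 = 1`, in integral form, so that `V` may be discontinuous in time. -/
def IsTimeOrderedExp {n : Type*} [Fintype n] [DecidableEq n]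
    (V U : ℝ → Matrix n n ℂ) (T : ℝ) : Prop :=
  ContinuousOn U (Icc 0 T) ∧
    ∀ t ∈ Icc 0 T, U t = 1 - Complex.I • ∫ s in (0 : ℝ)..t, V s * U s

/-- The (possibly time-dependent) Hamiltonian `V` drives the state `ρ` to the state `σ` in
time `T`. -/
structure Drives {n : Type*} [Fintype n] [DecidableEq n]
    (V : ℝ → Matrix n n ℂ) (T : ℝ) (ρ σ : Matrix n n ℂ) : Prop where
  time_nonneg : 0 ≤ T
  integrable : IntegrableOn V (Icc 0 T)
  hermitian : ∀ t ∈ Icc 0 T, (V t).IsHermitian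
  reaches : ∃ U : ℝ → Matrix n n ℂ, IsTimeOrderedExp V U T ∧ U T * ρ * (U T)ᴴ = σ

/-- The quantum charging distance: the minimal time in which a Hamiltonian of operator norm one
drives `ρ` to `σ`. -/
def chargingDistance {n : Type*} [Fintype n] [DecidableEq n] (ρ σ : Matrix n n ℂ) : ℝ :=
  sInf {T : ℝ | ∃ V : ℝ → Matrix n n ℂ, Drives V T ρ σ ∧ ∀ t ∈ Icc 0 T, ‖V t‖ = 1}

/-- The trace norm `‖A‖₁ = tr √(A† A)`. -/
def traceNorm {n : Type*} [Fintype n] [DecidableEq n] (A : Matrix n n ℂ) : ℝ :=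
  (CFC.sqrt (Aᴴ * A)).trace.re

/-- The trace distance. -/
def traceDistance {n : Type*} [Fintype n] [DecidableEq n] (ρ σ : Matrix n n ℂ) : ℝ :=
  (1 / 2) * traceNorm (ρ - σ)

/-- Uhlmann's fidelity `tr √(√ρ σ √ρ)`. -/
def fidelity {n : Type*} [Fintype n] [DecidableEq n] (ρ σ : Matrix n n ℂ) : ℝ :=
  (CFC.sqrt (CFC.sqrt ρ * σ * CFC.sqrt ρ)).trace.re

/-- The expectation value `tr (H ρ)` of the observable `H` in the state `ρ`. -/
def expectation {n : Type*} [Fintype n] (H ρ : Matrix n n ℂ) : ℝ :=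
  (H * ρ).trace.re

/-- The mean charging power. -/
def meanPower {n : Type*} [Fintype n] (H ρ σ : Matrix n n ℂ) (T : ℝ) : ℝ :=
  |expectation H ρ - expectation H σ| / T

end

end QuantumCharging

/-! The heart is that `chargingDistance ρ σ` is the least operator norm of a Hermitian `K` with `exp
(-i K)` taking `ρ` to `σ`. Under a drive of norm at most `v`, each unit vector moves on the sphere
with speed at most `v`, so by time `T` it has turned by an angle at most `v T`. If `v T ≤ π`, the
eigenvalues of the propagator then have arguments at most `v T` in modulus; otherwise the principal
branch gives this anyway. So the principal logarithm is a generator of norm at most `v T`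
(`Drives.exists_generator`), and a generator of least norm exists by compactness.

The power bound combines `D ≤ v T` with the duality `|tr H(ρ - σ)| ≤ 2 ‖H‖ D_Tr`. Both are
equalities for `H` proportional to the sign of `ρ - σ` and `V` constant along the optimal `K`.

For the ratio, `traceDistance_le_sqrt` bounds the numerator and `arccos_fidelity_le_norm` the
denominator; strictness is `sin x < x` at `x = arccos F`. -/

namespace QuantumCharging

/-! ### Traces and positive matrices -/

section Trace

variable {n : Type*} [Fintype n]

theorem re_trace_conjTranspose_mul_comm (X Y : Matrix n n ℂ) :
    (Yᴴ * X).trace.re = (Xᴴ * Y).trace.re := by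
  have h : (Yᴴ * X) = (Xᴴ * Y)ᴴ := by simp
  rw [h, Matrix.trace_conjTranspose]
  simp

theorem re_trace_conjTranspose_mul_self_nonneg (X : Matrix n n ℂ) :
    0 ≤ (Xᴴ * X).trace.re :=
  (Complex.nonneg_iff.mp (Matrix.posSemidef_conjTranspose_mul_self X).trace_nonneg).1

theorem re_trace_conjTranspose_mul_self {A ρ : Matrix n n ℂ} (h : A * Aᴴ = ρ)
    (hρ : ρ.trace = 1) : (Aᴴ * A).trace.re = 1 := by
  rw [Matrix.trace_mul_comm, h, hρ, Complex.one_re]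

/-- The Cauchy-Schwarz inequality for the Hilbert-Schmidt inner product. -/
theorem re_trace_conjTranspose_mul_sq_le (X Y : Matrix n n ℂ) :
    (Xᴴ * Y).trace.re ^ 2 ≤ (Xᴴ * X).trace.re * (Yᴴ * Y).trace.re := by
  have key : ∀ t : ℝ, 0 ≤ (Yᴴ * Y).trace.re * (t * t) + (2 * (Xᴴ * Y).trace.re) * t
      + (Xᴴ * X).trace.re := by
    intro t
    have h := re_trace_conjTranspose_mul_self_nonneg (X + (t : ℂ) • Y)
    have hc := re_trace_conjTranspose_mul_comm X Y
    simp only [Matrix.conjTranspose_add, Matrix.conjTranspose_smul, add_mul, mul_add,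
      Matrix.smul_mul, Matrix.mul_smul, Matrix.trace_add, Matrix.trace_smul, smul_eq_mul,
      Complex.add_re, RCLike.star_def, Complex.conj_ofReal, Complex.re_ofReal_mul] at h
    rw [hc] at h
    linarith
  have := discrim_le_zero key
  unfold discrim at this
  nlinarith

end Trace

variable {n : Type*} [Fintype n] [DecidableEq n]

theorem posSemidef_sqrt (A : Matrix n n ℂ) : (CFC.sqrt A).PosSemidef :=
  Matrix.nonneg_iff_posSemidef.mp (CFC.sqrt_nonneg A)

/-- Sandwich `C + Cᴴ ≤ ‖C + Cᴴ‖` between two copies of `√P` and take traces; `C` and `Cᴴ` contribute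
equal real parts. -/
theorem re_trace_mul_le_norm_mul_trace (C : Matrix n n ℂ) {P : Matrix n n ℂ} (hP : P.PosSemidef) :
    (C * P).trace.re ≤ ‖C‖ * P.trace.re := by
  set Q := CFC.sqrt P with hQ
  have hQ0 : Q.PosSemidef := posSemidef_sqrt P
  have hQQ : Q * Q = P := CFC.sqrt_mul_sqrt_self P hP.nonneg
  have hsa : IsSelfAdjoint (C + Cᴴ) := IsSelfAdjoint.add_star_self C
  have hle := hsa.le_algebraMap_norm_self
  rw [Matrix.le_iff] at hle
  have hpos := (hle.conjTranspose_mul_mul_same Q).trace_nonneg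
  rw [hQ0.1.eq] at hpos
  have hre := (Complex.nonneg_iff.mp hpos).1
  have hnorm : ‖C + Cᴴ‖ ≤ 2 * ‖C‖ := by
    calc ‖C + Cᴴ‖ ≤ ‖C‖ + ‖Cᴴ‖ := norm_add_le _ _
      _ = 2 * ‖C‖ := by rw [Matrix.l2_opNorm_conjTranspose]; ring
  have h1 : (Q * C * Q).trace = (C * P).trace := by
    rw [Matrix.trace_mul_comm, ← mul_assoc, hQQ, Matrix.trace_mul_comm]
  have h2 : (Q * Cᴴ * Q).trace.re = (C * P).trace.re := by
    rw [← h1]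
    have : Q * Cᴴ * Q = (Q * C * Q)ᴴ := by simp [hQ0.1.eq, mul_assoc]
    rw [this, Matrix.trace_conjTranspose]
    simp
  have h3 : (Q * (algebraMap ℝ (Matrix n n ℂ) ‖C + Cᴴ‖) * Q).trace.re
      = ‖C + Cᴴ‖ * P.trace.re := by
    rw [Algebra.algebraMap_eq_smul_one, Matrix.mul_smul, Matrix.smul_mul, mul_one, hQQ,
      Matrix.trace_smul]
    simp
  rw [mul_sub, sub_mul, Matrix.trace_sub, Complex.sub_re, h3, mul_add, add_mul,
    Matrix.trace_add, Complex.add_re, h1, h2] at hre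
  have htr : 0 ≤ P.trace.re := (Complex.nonneg_iff.mp hP.trace_nonneg).1
  nlinarith

theorem norm_toEuclideanCLM_apply_sq (M : Matrix n n ℂ) (x : EuclideanSpace ℂ n) :
    ‖Matrix.toEuclideanCLM (𝕜 := ℂ) M x‖ ^ 2 =
      (inner ℂ x (Matrix.toEuclideanCLM (𝕜 := ℂ) (Mᴴ * M) x)).re := by
  rw [← Matrix.star_eq_conjTranspose, map_mul, map_star, ContinuousLinearMap.star_eq_adjoint,
    mul_apply_eq_comp, ContinuousLinearMap.adjoint_inner_right,
    inner_self_eq_norm_sq_to_K]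
  norm_cast

/-- The polar decomposition of a square matrix, with a unitary factor. -/
theorem exists_unitary_mul_sqrt (M : Matrix n n ℂ) :
    ∃ W ∈ Matrix.unitaryGroup n ℂ, M = W * CFC.sqrt (Mᴴ * M) := by
  set φ := Matrix.toEuclideanCLM (n := n) (𝕜 := ℂ) with hφ
  set P := CFC.sqrt (Mᴴ * M) with hP
  have hP0 : P.PosSemidef := posSemidef_sqrt _
  have hPP : Pᴴ * P = Mᴴ * M := by
    rw [hP0.1.eq]
    exact CFC.sqrt_mul_sqrt_self _ (Matrix.posSemidef_conjTranspose_mul_self M).nonneg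
  have hnorm : ∀ x, ‖φ M x‖ = ‖φ P x‖ := by
    intro x
    have : ‖φ M x‖ ^ 2 = ‖φ P x‖ ^ 2 := by
      rw [norm_toEuclideanCLM_apply_sq, norm_toEuclideanCLM_apply_sq, hPP]
    exact (sq_eq_sq₀ (norm_nonneg _) (norm_nonneg _)).mp this
  -- Equality of norms makes `P x ↦ M x` a well-defined isometry on the range of `P`. In finite
  -- dimension it extends to the whole space, so the factor is unitary even for singular `M`.
  let f : EuclideanSpace ℂ n →ₗ[ℂ] EuclideanSpace ℂ n := (φ P).toLinearMap
  let g : EuclideanSpace ℂ n →ₗ[ℂ] EuclideanSpace ℂ n := (φ M).toLinearMap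
  have hker : f.ker ≤ g.ker := by
    intro x hx
    have hx' : φ P x = 0 := hx
    have : ‖φ M x‖ = 0 := by rw [hnorm, hx', norm_zero]
    exact norm_eq_zero.mp this
  let l : f.range →ₗ[ℂ] EuclideanSpace ℂ n :=
    (f.ker.liftQ g hker) ∘ₗ f.quotKerEquivRange.symm.toLinearMap
  have hl : ∀ x, l ⟨f x, x, rfl⟩ = g x := by
    intro x
    have : f.quotKerEquivRange.symm ⟨f x, x, rfl⟩ = f.ker.mkQ x := by
      rw [LinearEquiv.symm_apply_eq]
      rfl
    simp [l, this]
  let L : f.range →ₗᵢ[ℂ] EuclideanSpace ℂ n :=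
    ⟨l, by
      rintro ⟨_, x, rfl⟩
      rw [hl]
      exact hnorm x⟩
  let W := L.extend.toContinuousLinearMap
  have hWM : φ M = W * φ P := by
    ext1 x
    have : L.extend (f x) = L ⟨f x, x, rfl⟩ := L.extend_apply ⟨f x, x, rfl⟩
    exact ((this.trans (hl x)).symm)
  have hWW : star W * W = 1 := by
    rw [ContinuousLinearMap.star_eq_adjoint]
    exact (ContinuousLinearMap.norm_map_iff_adjoint_comp_self W).mp L.extend.norm_map
  refine ⟨φ.symm W, ?_, ?_⟩
  · rw [Matrix.mem_unitaryGroup_iff']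
    apply (EquivLike.injective φ : Function.Injective φ)
    rw [map_mul, map_star, φ.apply_symm_apply, map_one, hWW]
  · apply (EquivLike.injective φ : Function.Injective φ)
    rw [map_mul, φ.apply_symm_apply, hWM]

theorem norm_unitary_le_one {W : Matrix n n ℂ} (hW : W ∈ Matrix.unitaryGroup n ℂ) : ‖W‖ ≤ 1 := by
  have h : Wᴴ * W = 1 := Matrix.mem_unitaryGroup_iff'.mp hW
  have h2 := Matrix.l2_opNorm_conjTranspose_mul_self W
  rw [h] at h2
  have h1 : ‖(1 : Matrix n n ℂ)‖ ≤ 1 := by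
    rcases isEmpty_or_nonempty n with hn | hn
    · rw [Subsingleton.elim (1 : Matrix n n ℂ) 0, norm_zero]; exact zero_le_one
    · rw [CStarRing.norm_one]
  nlinarith [norm_nonneg W]

/-! ### The trace norm -/

theorem re_trace_mul_le_norm_mul_traceNorm (C X : Matrix n n ℂ) :
    (C * X).trace.re ≤ ‖C‖ * traceNorm X := by
  obtain ⟨W, hW, hX⟩ := exists_unitary_mul_sqrt X
  have hP : (CFC.sqrt (Xᴴ * X)).PosSemidef := posSemidef_sqrt _
  have htr : 0 ≤ traceNorm X := (Complex.nonneg_iff.mp hP.trace_nonneg).1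
  calc (C * X).trace.re = (C * W * CFC.sqrt (Xᴴ * X)).trace.re := by rw [mul_assoc, ← hX]
    _ ≤ ‖C * W‖ * traceNorm X := re_trace_mul_le_norm_mul_trace _ hP
    _ ≤ ‖C‖ * traceNorm X := by
      refine mul_le_mul_of_nonneg_right ?_ htr
      calc ‖C * W‖ ≤ ‖C‖ * ‖W‖ := norm_mul_le _ _
        _ ≤ ‖C‖ * 1 := by gcongr; exact norm_unitary_le_one hW
        _ = ‖C‖ := mul_one _

theorem traceDistance_nonneg (ρ σ : Matrix n n ℂ) : 0 ≤ traceDistance ρ σ := by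
  have hP : (CFC.sqrt ((ρ - σ)ᴴ * (ρ - σ))).PosSemidef := posSemidef_sqrt _
  exact mul_nonneg (by norm_num) (Complex.nonneg_iff.mp hP.trace_nonneg).1

theorem abs_expectation_sub_le (H ρ σ : Matrix n n ℂ) :
    |expectation H ρ - expectation H σ| ≤ 2 * ‖H‖ * traceDistance ρ σ := by
  have h : expectation H ρ - expectation H σ = (H * (ρ - σ)).trace.re := by
    simp [expectation, mul_sub]
  have h1 := re_trace_mul_le_norm_mul_traceNorm H (ρ - σ)
  have h2 := re_trace_mul_le_norm_mul_traceNorm (-H) (ρ - σ)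
  rw [norm_neg, neg_mul, Matrix.trace_neg, Complex.neg_re] at h2
  rw [h, traceDistance, abs_le]
  constructor <;> linarith

/-- The sign of a Hermitian matrix, with value one on the kernel. -/
theorem exists_sign {X : Matrix n n ℂ} (hX : X.IsHermitian) :
    ∃ S : Matrix n n ℂ, S.IsHermitian ∧ S * S = 1 ∧ S * X = CFC.sqrt (Xᴴ * X) := by
  have hsa : IsSelfAdjoint X := hX
  let s : ℝ → ℝ := fun x => if 0 ≤ x then 1 else -1
  -- The spectrum is finite, so the functional calculus accepts the discontinuous sign.
  have hc : ∀ f : ℝ → ℝ, ContinuousOn f (spectrum ℝ X) := by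
    intro f
    have hfin : (spectrum ℝ X).Finite := by
      rw [hX.spectrum_real_eq_range_eigenvalues]
      exact Set.finite_range _
    exact hfin.continuousOn f
  refine ⟨cfc s X, cfc_predicate s X, ?_, ?_⟩
  · rw [← cfc_mul s s X (hc _) (hc _), ← cfc_one ℝ X]
    congr 1
    ext x
    by_cases h : 0 ≤ x <;> simp [s, h]
  · have habs : CFC.sqrt (Xᴴ * X) = cfc (fun x : ℝ => ‖x‖) X := CFC.abs_eq_cfc_norm X hsa
    rw [habs]
    nth_rw 2 [← cfc_id ℝ X]
    rw [← cfc_mul s id X (hc _) (hc _)]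
    congr 1
    ext x
    by_cases h : 0 ≤ x
    · simp [s, h, abs_of_nonneg h]
    · simp [s, h, abs_of_neg (not_le.mp h)]

theorem norm_eq_one_of_mul_self [Nonempty n] {S : Matrix n n ℂ} (hS : S.IsHermitian)
    (h : S * S = 1) : ‖S‖ = 1 := by
  have h2 := Matrix.l2_opNorm_conjTranspose_mul_self S
  rw [hS.eq, h, CStarRing.norm_one] at h2
  nlinarith [norm_nonneg S]

/-- The duality between the trace norm and the operator norm is attained. -/
theorem exists_expectation_sub_eq [Nonempty n] {ρ σ : Matrix n n ℂ} (hρ : ρ.IsHermitian)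
    (hσ : σ.IsHermitian) :
    ∃ S : Matrix n n ℂ, S.IsHermitian ∧ ‖S‖ = 1 ∧
      expectation S ρ - expectation S σ = 2 * traceDistance ρ σ := by
  obtain ⟨S, hS, hSS, hSX⟩ := exists_sign (hρ.sub hσ)
  refine ⟨S, hS, norm_eq_one_of_mul_self hS hSS, ?_⟩
  have h : expectation S ρ - expectation S σ = (S * (ρ - σ)).trace.re := by
    simp [expectation, mul_sub]
  rw [h, hSX, traceDistance, traceNorm]
  ring

/-! ### The fidelity -/

theorem fidelity_eq_traceNorm {ρ σ : Matrix n n ℂ} (hσ : σ.PosSemidef) :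
    fidelity ρ σ = traceNorm (CFC.sqrt σ * CFC.sqrt ρ) := by
  have hsρ : (CFC.sqrt ρ).PosSemidef := posSemidef_sqrt _
  have hsσ : (CFC.sqrt σ).PosSemidef := posSemidef_sqrt _
  rw [fidelity, traceNorm, Matrix.conjTranspose_mul, hsρ.1.eq, hsσ.1.eq]
  rw [mul_assoc (CFC.sqrt ρ) (CFC.sqrt σ), ← mul_assoc (CFC.sqrt σ),
    CFC.sqrt_mul_sqrt_self σ hσ.nonneg, ← mul_assoc]

theorem fidelity_nonneg (ρ σ : Matrix n n ℂ) : 0 ≤ fidelity ρ σ :=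
  (Complex.nonneg_iff.mp (posSemidef_sqrt _).trace_nonneg).1

/-- Optimal purifications, in the sense of Uhlmann. -/
theorem exists_purifications {ρ σ : Matrix n n ℂ} (hρ : ρ.PosSemidef) (hσ : σ.PosSemidef) :
    ∃ A B : Matrix n n ℂ, A * Aᴴ = ρ ∧ B * Bᴴ = σ ∧ (Bᴴ * A).trace.re = fidelity ρ σ := by
  obtain ⟨W, hW, hM⟩ := exists_unitary_mul_sqrt (CFC.sqrt σ * CFC.sqrt ρ)
  have hsρ : (CFC.sqrt ρ).PosSemidef := posSemidef_sqrt _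
  have hsσ : (CFC.sqrt σ).PosSemidef := posSemidef_sqrt _
  have h1 : Wᴴ * W = 1 := Matrix.mem_unitaryGroup_iff'.mp hW
  have h2 : W * Wᴴ = 1 := Matrix.mem_unitaryGroup_iff.mp hW
  -- The polar unitary of `√σ √ρ` is absorbed into `B`, which turns `Bᴴ A` into the modulus `|√σ
  -- √ρ|`.
  refine ⟨CFC.sqrt ρ, CFC.sqrt σ * W, ?_, ?_, ?_⟩
  · rw [hsρ.1.eq, CFC.sqrt_mul_sqrt_self ρ hρ.nonneg]
  · rw [Matrix.conjTranspose_mul, hsσ.1.eq, mul_assoc, ← mul_assoc W, h2, one_mul,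
      CFC.sqrt_mul_sqrt_self σ hσ.nonneg]
  · rw [Matrix.conjTranspose_mul, hsσ.1.eq, mul_assoc, hM, ← mul_assoc, h1, one_mul,
      fidelity_eq_traceNorm hσ, traceNorm]

/-- Optimal purifications are Hilbert-Schmidt unit vectors at squared distance `2 - 2F`, so `F ≥ 1`
would make them coincide. -/
theorem fidelity_lt_one {ρ σ : Matrix n n ℂ} (hρ : IsDensityMatrix ρ) (hσ : IsDensityMatrix σ)
    (hne : ρ ≠ σ) : fidelity ρ σ < 1 := by
  obtain ⟨A, B, hA, hB, hF⟩ := exists_purifications hρ.1 hσ.1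
  by_contra! h
  apply hne
  have h0 := re_trace_conjTranspose_mul_self_nonneg (A - B)
  have h1 : ((A - B)ᴴ * (A - B)).trace.re = 2 - 2 * fidelity ρ σ := by
    simp only [Matrix.conjTranspose_sub, sub_mul, mul_sub, Matrix.trace_sub, Complex.sub_re]
    rw [re_trace_conjTranspose_mul_self hA hρ.2, re_trace_conjTranspose_mul_self hB hσ.2,
      re_trace_conjTranspose_mul_comm B A, hF]
    ring
  have h2 : ((A - B)ᴴ * (A - B)).trace = 0 := by
    have hnn := Complex.nonneg_iff.mp (Matrix.posSemidef_conjTranspose_mul_self (A - B)).trace_nonneg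
    apply Complex.ext
    · rw [Complex.zero_re]; linarith
    · rw [← hnn.2, Complex.zero_im]
  have h3 : A = B := sub_eq_zero.mp (Matrix.trace_conjTranspose_mul_self_eq_zero_iff.mp h2)
  rw [← hA, ← hB, h3]

/-- The upper Fuchs-van de Graaf inequality. -/
theorem traceDistance_le_sqrt {ρ σ : Matrix n n ℂ} (hρ : IsDensityMatrix ρ)
    (hσ : IsDensityMatrix σ) : traceDistance ρ σ ≤ √(1 - fidelity ρ σ ^ 2) := by
  obtain ⟨A, B, hA, hB, hF⟩ := exists_purifications hρ.1 hσ.1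
  obtain ⟨S, hS, hSS, hSX⟩ := exists_sign (hρ.1.1.sub hσ.1.1)
  have hA1 := re_trace_conjTranspose_mul_self hA hρ.2
  have hB1 := re_trace_conjTranspose_mul_self hB hσ.2
  have hAB := re_trace_conjTranspose_mul_comm B A
  apply Real.le_sqrt_of_sq_le
  -- The cross terms of `(A - B)(A + B)ᴴ` form an anti-Hermitian matrix, invisible to the real trace
  -- against `S`. Cauchy-Schwarz with squared norms `2 + 2F` and `2 - 2F` then gives the bound.
  have hN : traceNorm (ρ - σ) = ((S * (A + B))ᴴ * (A - B)).trace.re := by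
    have e1 : traceNorm (ρ - σ) = (S * (ρ - σ)).trace.re := by rw [traceNorm, hSX]
    have e2 : ((S * (A + B))ᴴ * (A - B)).trace
        = (S * (A * Aᴴ - B * Bᴴ)).trace + ((S * (A * Bᴴ)).trace - (S * (B * Aᴴ)).trace) := by
      rw [Matrix.conjTranspose_mul, hS.eq, mul_assoc, Matrix.trace_mul_comm, mul_assoc,
        ← Matrix.trace_sub, ← Matrix.trace_add, ← mul_sub, ← mul_add, Matrix.conjTranspose_add]
      congr 2
      noncomm_ring
    have e3 : (S * (A * Bᴴ)).trace.re = (S * (B * Aᴴ)).trace.re := by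
      have : S * (A * Bᴴ) = (B * Aᴴ * S)ᴴ := by simp [hS.eq]
      rw [this, Matrix.trace_conjTranspose, Matrix.trace_mul_comm]
      simp
    rw [e1, e2, Complex.add_re, Complex.sub_re, e3, hA, hB]
    ring
  have hCS := re_trace_conjTranspose_mul_sq_le (S * (A + B)) (A - B)
  have p1 : ((S * (A + B))ᴴ * (S * (A + B))).trace.re = 2 + 2 * fidelity ρ σ := by
    have : (S * (A + B))ᴴ * (S * (A + B)) = (A + B)ᴴ * (A + B) := by
      rw [Matrix.conjTranspose_mul, hS.eq, mul_assoc, ← mul_assoc S, hSS, one_mul]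
    rw [this]
    simp only [Matrix.conjTranspose_add, add_mul, mul_add, Matrix.trace_add, Complex.add_re]
    rw [hA1, hB1, hAB, hF]
    ring
  have p2 : ((A - B)ᴴ * (A - B)).trace.re = 2 - 2 * fidelity ρ σ := by
    simp only [Matrix.conjTranspose_sub, sub_mul, mul_sub, Matrix.trace_sub, Complex.sub_re]
    rw [hA1, hB1, hAB, hF]
    ring
  rw [p1, p2, ← hN] at hCS
  rw [traceDistance]
  nlinarith

theorem sqrt_unitary_conj {ρ U : Matrix n n ℂ} (hρ : ρ.PosSemidef)
    (hU : U ∈ Matrix.unitaryGroup n ℂ) :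
    CFC.sqrt (U * ρ * Uᴴ) = U * CFC.sqrt ρ * Uᴴ := by
  have h1 : Uᴴ * U = 1 := Matrix.mem_unitaryGroup_iff'.mp hU
  have hsρ : (CFC.sqrt ρ).PosSemidef := posSemidef_sqrt _
  rw [CFC.sqrt_eq_iff _ _ (hρ.mul_mul_conjTranspose_same U).nonneg
    (hsρ.mul_mul_conjTranspose_same U).nonneg]
  calc U * CFC.sqrt ρ * Uᴴ * (U * CFC.sqrt ρ * Uᴴ)
      = U * CFC.sqrt ρ * (Uᴴ * U) * CFC.sqrt ρ * Uᴴ := by noncomm_ring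
    _ = U * (CFC.sqrt ρ * CFC.sqrt ρ) * Uᴴ := by rw [h1]; noncomm_ring
    _ = U * ρ * Uᴴ := by rw [CFC.sqrt_mul_sqrt_self ρ hρ.nonneg]

/-- Here `√σ √ρ = U √ρ Uᴴ √ρ`; testing its trace norm against the contraction `Uᴴ` leaves `Re tr (U
ρ)`. -/
theorem re_trace_mul_le_fidelity {ρ U : Matrix n n ℂ} (hρ : ρ.PosSemidef)
    (hU : U ∈ Matrix.unitaryGroup n ℂ) :
    (U * ρ).trace.re ≤ fidelity ρ (U * ρ * Uᴴ) := by
  have h1 : Uᴴ * U = 1 := Matrix.mem_unitaryGroup_iff'.mp hU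
  have hsρ : (CFC.sqrt ρ).PosSemidef := posSemidef_sqrt _
  have hpos : 0 ≤ fidelity ρ (U * ρ * Uᴴ) := fidelity_nonneg _ _
  have h := re_trace_mul_le_norm_mul_traceNorm Uᴴ
    (CFC.sqrt (U * ρ * Uᴴ) * CFC.sqrt ρ)
  rw [← fidelity_eq_traceNorm (hρ.mul_mul_conjTranspose_same U), sqrt_unitary_conj hρ hU,
    Matrix.l2_opNorm_conjTranspose] at h
  have h2 : (Uᴴ * (U * CFC.sqrt ρ * Uᴴ * CFC.sqrt ρ)).trace.re = (U * ρ).trace.re := by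
    have e : Uᴴ * (U * CFC.sqrt ρ * Uᴴ * CFC.sqrt ρ) = (CFC.sqrt ρ * (U * CFC.sqrt ρ))ᴴ := by
      calc Uᴴ * (U * CFC.sqrt ρ * Uᴴ * CFC.sqrt ρ)
          = (Uᴴ * U) * CFC.sqrt ρ * Uᴴ * CFC.sqrt ρ := by noncomm_ring
        _ = _ := by rw [h1]; simp [hsρ.1.eq]
    rw [e, Matrix.trace_conjTranspose, Matrix.trace_mul_comm, mul_assoc,
      CFC.sqrt_mul_sqrt_self ρ hρ.nonneg]
    simp
  rw [h2] at h
  nlinarith [norm_unitary_le_one hU]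

end QuantumCharging

namespace QuantumCharging

/-! ### Lipschitz paths on the unit sphere -/

section Sphere

open InnerProductGeometry

variable {E : Type*} [NormedAddCommGroup E] [InnerProductSpace ℝ E]

theorem norm_sub_sq_eq_cos_angle {x y : E} (hx : ‖x‖ = 1) (hy : ‖y‖ = 1) :
    ‖x - y‖ ^ 2 = 2 - 2 * Real.cos (angle x y) := by
  have h := norm_sub_sq_real x y
  have hc := cos_angle_mul_norm_mul_norm x y
  rw [hx, hy] at hc h
  linarith

/-- The chord is `2 sin (θ / 2)`. A cubic error is small enough to vanish after summation over ever
finer subdivisions. -/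
theorem angle_le_add_cube {x y : E} (hx : ‖x‖ = 1) (hy : ‖y‖ = 1) {d : ℝ} (hd : ‖x - y‖ ≤ d) :
    angle x y ≤ d + d ^ 3 := by
  set θ := angle x y with hθ
  have h0 : 0 ≤ θ := angle_nonneg x y
  have hpi : θ ≤ Real.pi := angle_le_pi x y
  have hd0 : 0 ≤ d := (norm_nonneg _).trans hd
  have hsin0 : 0 ≤ Real.sin (θ / 2) := Real.sin_nonneg_of_nonneg_of_le_pi (by linarith) (by linarith)
  have hsq : ‖x - y‖ ^ 2 = (2 * Real.sin (θ / 2)) ^ 2 := by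
    rw [norm_sub_sq_eq_cos_angle hx hy, ← hθ, mul_pow, Real.sin_sq_eq_half_sub]
    rw [show 2 * (θ / 2) = θ by ring]
    ring
  have hsin : 2 * Real.sin (θ / 2) ≤ d := by
    rw [← (sq_eq_sq₀ (norm_nonneg _) (by linarith)).mp hsq]
    exact hd
  have hJ := Real.mul_le_sin (x := θ / 2) (by linarith) (by linarith)
  -- Jordan's inequality gives this crude bound, needed only to control the cubic term.
  have hy : θ / 2 ≤ d := by
    have h4 : 2 / Real.pi ≥ 1 / 2 := by
      rw [ge_iff_le, div_le_div_iff₀ (by norm_num) Real.pi_pos]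
      linarith [Real.pi_le_four]
    nlinarith
  have hcube : θ / 2 - (θ / 2) ^ 3 / 6 ≤ Real.sin (θ / 2) := by
    rcases h0.eq_or_lt with h | h
    · simp [← h]
    · exact (Real.sin_gt_sub_cube (by linarith)).le
  have h3 : (θ / 2) ^ 3 ≤ d ^ 3 := by gcongr
  have : 0 ≤ d ^ 3 := by positivity
  linarith

/-- The geodesic distance between the end points of a path on the unit sphere is at most its
length. -/
theorem angle_le_of_lipschitz {x : ℝ → E} {T v : ℝ} (hT : 0 ≤ T)
    (h1 : ∀ t ∈ Icc 0 T, ‖x t‖ = 1)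
    (hL : ∀ s ∈ Icc 0 T, ∀ t ∈ Icc 0 T, s ≤ t → ‖x s - x t‖ ≤ v * (t - s)) :
    angle (x 0) (x T) ≤ v * T := by
  have hmem : ∀ N : ℕ, 0 < N → ∀ k : ℕ, k ≤ N → (k : ℝ) * (T / N) ∈ Icc 0 T := by
    intro N hN k hk
    have hN' : (0 : ℝ) < N := by exact_mod_cast hN
    have hk' : (k : ℝ) ≤ N := by exact_mod_cast hk
    refine ⟨by positivity, ?_⟩
    calc (k : ℝ) * (T / N) ≤ N * (T / N) := by gcongr
      _ = T := by field_simp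
  have hstep : ∀ N : ℕ, 0 < N → ∀ k : ℕ, k ≤ N →
      angle (x 0) (x (k * (T / N))) ≤ k * (v * (T / N) + (v * (T / N)) ^ 3) := by
    intro N hN k
    induction k with
    | zero =>
      intro _
      have h0 := h1 0 ⟨le_rfl, hT⟩
      have hne : x 0 ≠ 0 := by
        intro h
        rw [h, norm_zero] at h0
        exact zero_ne_one h0
      simp [angle_self hne]
    | succ k ih =>
      intro hk
      have m1 := hmem N hN k (by omega)
      have m2 := hmem N hN (k + 1) hk
      have hle : (k : ℝ) * (T / N) ≤ ((k + 1 : ℕ) : ℝ) * (T / N) := by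
        push_cast
        gcongr
        linarith
      have hd := hL _ m1 _ m2 hle
      have heq : v * (((k + 1 : ℕ) : ℝ) * (T / N) - (k : ℝ) * (T / N)) = v * (T / N) := by
        push_cast; ring
      rw [heq] at hd
      have ha := angle_le_add_cube (h1 _ m1) (h1 _ m2) hd
      have ht := angle_le_angle_add_angle (x 0) (x (k * (T / N))) (x ((k + 1 : ℕ) * (T / N)))
      have := ih (by omega)
      push_cast at *
      linarith
  -- The `N` cubic errors `(v T / N) ^ 3` add up to order `1 / N ^ 2`.
  have hbound : ∀ N : ℕ, 0 < N → angle (x 0) (x T) ≤ v * T + (v * T) ^ 3 * (1 / (N : ℝ)) ^ 2 := by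
    intro N hN
    have hN' : (N : ℝ) ≠ 0 := by exact_mod_cast hN.ne'
    have h := hstep N hN N le_rfl
    rw [show (N : ℝ) * (T / N) = T by field_simp] at h
    calc _ ≤ _ := h
      _ = _ := by field_simp
  have hlim : Filter.Tendsto (fun N : ℕ => v * T + (v * T) ^ 3 * (1 / (N : ℝ)) ^ 2) Filter.atTop
      (nhds (v * T + (v * T) ^ 3 * 0 ^ 2)) :=
    ((tendsto_one_div_atTop_nhds_zero_nat.pow 2).const_mul _).const_add _
  have := ge_of_tendsto hlim (Filter.eventually_atTop.mpr ⟨1, fun N hN => hbound N hN⟩)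
  simpa using this

end Sphere

/-! ### Time-ordered exponentials -/

variable {n : Type*} [Fintype n] [DecidableEq n] {V U : ℝ → Matrix n n ℂ} {T v : ℝ}

theorem integrableOn_mul_propagator (hV : IntegrableOn V (Icc 0 T))
    (hU : ContinuousOn U (Icc 0 T)) : IntegrableOn (fun s => V s * U s) (Icc 0 T) :=
  hV.mul_continuousOn hU isCompact_Icc

theorem intervalIntegrable_of_integrableOn {f : ℝ → Matrix n n ℂ}
    (hf : IntegrableOn f (Icc 0 T)) {s t : ℝ} (hs : s ∈ Icc 0 T) (ht : t ∈ Icc 0 T) :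
    IntervalIntegrable f volume s t :=
  (hf.mono_set (uIcc_subset_Icc hs ht)).intervalIntegrable

theorem propagator_sub (hV : IntegrableOn V (Icc 0 T)) (hU : IsTimeOrderedExp V U T) {s t : ℝ}
    (hs : s ∈ Icc 0 T) (ht : t ∈ Icc 0 T) :
    U t - U s = -(Complex.I • ∫ r in s..t, V r * U r) := by
  have hI := integrableOn_mul_propagator hV hU.1
  have h0 : (0 : ℝ) ∈ Icc 0 T := ⟨le_rfl, hs.1.trans hs.2⟩
  rw [hU.2 t ht, hU.2 s hs, ← intervalIntegral.integral_interval_sub_left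
    (intervalIntegrable_of_integrableOn hI h0 ht) (intervalIntegrable_of_integrableOn hI h0 hs),
    smul_sub]
  abel

theorem norm_propagator_sub_le (hV : IntegrableOn V (Icc 0 T)) (hU : IsTimeOrderedExp V U T)
    (hv : ∀ t ∈ Icc 0 T, ‖V t‖ ≤ v) {M : ℝ} (hM : ∀ t ∈ Icc 0 T, ‖U t‖ ≤ M) {s t : ℝ}
    (hs : s ∈ Icc 0 T) (ht : t ∈ Icc 0 T) (hst : s ≤ t) :
    ‖U t - U s‖ ≤ v * M * (t - s) := by
  rw [propagator_sub hV hU hs ht, norm_neg, norm_smul, Complex.norm_I, one_mul,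
    ← abs_of_nonneg (sub_nonneg.mpr hst)]
  refine intervalIntegral.norm_integral_le_of_norm_le_const fun r hr => ?_
  rw [uIoc_of_le hst] at hr
  have hr' : r ∈ Icc 0 T := ⟨hs.1.trans hr.1.le, hr.2.trans ht.2⟩
  calc ‖V r * U r‖ ≤ ‖V r‖ * ‖U r‖ := norm_mul_le _ _
    _ ≤ v * M := mul_le_mul (hv r hr') (hM r hr') (norm_nonneg _)
      ((norm_nonneg _).trans (hv r hr'))

theorem isHermitian_integral (hh : ∀ t ∈ Icc 0 T, (V t).IsHermitian) {s t : ℝ}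
    (hs : s ∈ Icc 0 T) (ht : t ∈ Icc 0 T) :
    (∫ r in s..t, V r).IsHermitian := by
  have h : star (∫ r in s..t, V r) = ∫ r in s..t, star (V r) := by
    have hstar (μ : Measure ℝ) : star (∫ r, V r ∂μ) = ∫ r, star (V r) ∂μ :=
      ((starL' ℝ : Matrix n n ℂ ≃L[ℝ] Matrix n n ℂ).integral_comp_comm V).symm
    simp only [intervalIntegral, star_sub, hstar]
  change star _ = _
  rw [h]
  refine intervalIntegral.integral_congr fun r hr => ?_
  exact hh r (uIcc_subset_Icc hs ht hr)

/-- Since `V` is only integrable, `U` need not be differentiable at every time. The first-order part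
of the increment of `Uᴴ U` nevertheless cancels because `∫ V` is Hermitian, and the quadratic
remainder gives `Uᴴ U` zero right derivative everywhere. -/
theorem norm_conjTranspose_mul_propagator_sub_le (hV : IntegrableOn V (Icc 0 T))
    (hh : ∀ t ∈ Icc 0 T, (V t).IsHermitian) (hU : IsTimeOrderedExp V U T)
    (hv : ∀ t ∈ Icc 0 T, ‖V t‖ ≤ v) {M : ℝ} (hM : ∀ t ∈ Icc 0 T, ‖U t‖ ≤ M) {s t : ℝ}
    (hs : s ∈ Icc 0 T) (ht : t ∈ Icc 0 T) (hst : s ≤ t) :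
    ‖(U t)ᴴ * U t - (U s)ᴴ * U s‖ ≤ 3 * (v * M) ^ 2 * (t - s) ^ 2 := by
  set W := ∫ r in s..t, V r with hW
  have hWh : Wᴴ = W := isHermitian_integral hh hs ht
  have hv0 : 0 ≤ v := (norm_nonneg _).trans (hv s hs)
  have hM0 : 0 ≤ M := (norm_nonneg _).trans (hM s hs)
  have hVU := intervalIntegrable_of_integrableOn (integrableOn_mul_propagator hV hU.1) hs ht
  have hVs : IntervalIntegrable (fun r => V r * U s) volume s t :=
    intervalIntegrable_of_integrableOn
      (integrableOn_mul_propagator hV (continuousOn_const (c := U s))) hs ht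
  set Δ := U t - U s with hΔ
  have hΔn : ‖Δ‖ ≤ v * M * (t - s) := norm_propagator_sub_le hV hU hv hM hs ht hst
  set R := Δ + Complex.I • (W * U s) with hR
  have hRint : R = -(Complex.I • ∫ r in s..t, V r * (U r - U s)) := by
    have hWU : W * U s = ∫ r in s..t, V r * U s :=
      (((ContinuousLinearMap.mul ℝ (Matrix n n ℂ)).flip (U s)).intervalIntegral_comp_comm
        (intervalIntegrable_of_integrableOn hV hs ht)).symm
    rw [hR, hΔ, propagator_sub hV hU hs ht, hWU]
    simp only [mul_sub]
    rw [intervalIntegral.integral_sub hVU hVs, smul_sub]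
    abel
  have hRn : ‖R‖ ≤ v * (v * M * (t - s)) * (t - s) := by
    rw [hRint, norm_neg, norm_smul, Complex.norm_I, one_mul]
    nth_rw 2 [← abs_of_nonneg (sub_nonneg.mpr hst)]
    refine intervalIntegral.norm_integral_le_of_norm_le_const fun r hr => ?_
    rw [uIoc_of_le hst] at hr
    have hr' : r ∈ Icc 0 T := ⟨hs.1.trans hr.1.le, hr.2.trans ht.2⟩
    calc ‖V r * (U r - U s)‖ ≤ ‖V r‖ * ‖U r - U s‖ := norm_mul_le _ _
      _ ≤ v * (v * M * (r - s)) := mul_le_mul (hv r hr')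
          (norm_propagator_sub_le hV hU hv hM hs hr' hr.1.le) (norm_nonneg _) hv0
      _ ≤ v * (v * M * (t - s)) := by gcongr; exact hr.2
  -- With `Δ = R - i W U s`, the two terms `± i (U s)ᴴ W U s` cancel; the three left are each of
  -- second order, whence the constant 3.
  have hid : (U t)ᴴ * U t - (U s)ᴴ * U s = (U s)ᴴ * R + Rᴴ * U s + Δᴴ * Δ := by
    have e1 : U t = U s + Δ := by rw [hΔ]; abel
    rw [e1, hR]
    simp only [Matrix.conjTranspose_add, Matrix.conjTranspose_smul, Matrix.conjTranspose_mul, hWh,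
      add_mul, mul_add, Matrix.smul_mul, Matrix.mul_smul, mul_assoc, RCLike.star_def,
      Complex.conj_I, neg_smul, neg_mul]
    abel
  rw [hid]
  have b1 : ‖(U s)ᴴ * R‖ ≤ M * (v * (v * M * (t - s)) * (t - s)) :=
    (norm_mul_le _ _).trans (mul_le_mul
      ((Matrix.l2_opNorm_conjTranspose (U s)).le.trans (hM s hs)) hRn (norm_nonneg _) hM0)
  have b2 : ‖Rᴴ * U s‖ ≤ M * (v * (v * M * (t - s)) * (t - s)) := by
    rw [← Matrix.l2_opNorm_conjTranspose]
    simpa using b1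
  have b3 : ‖Δᴴ * Δ‖ ≤ (v * M * (t - s)) * (v * M * (t - s)) := by
    rw [Matrix.l2_opNorm_conjTranspose_mul_self]
    exact mul_self_le_mul_self (norm_nonneg _) hΔn
  calc _ ≤ ‖(U s)ᴴ * R‖ + ‖Rᴴ * U s‖ + ‖Δᴴ * Δ‖ := norm_add₃_le
    _ ≤ _ := add_le_add (add_le_add b1 b2) b3
    _ = _ := by ring

theorem propagator_zero (hT : 0 ≤ T) (hU : IsTimeOrderedExp V U T) : U 0 = 1 := by
  simpa using hU.2 0 ⟨le_rfl, hT⟩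

/-- The propagator of a bounded Hamiltonian is unitary. -/
theorem propagator_mem_unitaryGroup (hV : IntegrableOn V (Icc 0 T))
    (hh : ∀ t ∈ Icc 0 T, (V t).IsHermitian) (hU : IsTimeOrderedExp V U T)
    (hv : ∀ t ∈ Icc 0 T, ‖V t‖ ≤ v) {t : ℝ} (ht : t ∈ Icc 0 T) :
    U t ∈ Matrix.unitaryGroup n ℂ := by
  obtain ⟨M, hM⟩ := isCompact_Icc.exists_bound_of_continuousOn hU.1
  have hcont : ContinuousOn (fun t => (U t)ᴴ * U t) (Icc 0 T) := hU.1.star.mul hU.1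
  have hconst := constant_of_has_deriv_right_zero hcont (fun s hs => by
    rw [hasDerivWithinAt_iff_isLittleO]
    have hs' : s ∈ Icc 0 T := ⟨hs.1, hs.2.le⟩
    have hO : (fun t => (U t)ᴴ * U t - (U s)ᴴ * U s - (t - s) • (0 : Matrix n n ℂ))
        =O[nhdsWithin s (Ici s)] fun t => (t - s) ^ 2 := by
      refine Asymptotics.IsBigO.of_bound (3 * (v * M) ^ 2) ?_
      have hmem : Icc s T ∈ nhdsWithin s (Ici s) := Icc_mem_nhdsGE hs.2
      filter_upwards [hmem] with t ht
      rw [smul_zero, sub_zero, Real.norm_of_nonneg (sq_nonneg _)]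
      exact norm_conjTranspose_mul_propagator_sub_le hV hh hU hv hM hs'
        ⟨hs.1.trans ht.1, ht.2⟩ ht.1
    refine hO.trans_isLittleO ?_
    have hl : (fun t : ℝ => t - s) =o[nhdsWithin s (Ici s)] fun _ => (1 : ℝ) := by
      rw [Asymptotics.isLittleO_one_iff]
      have : Filter.Tendsto (fun t : ℝ => t - s) (nhds s) (nhds (s - s)) :=
        (continuous_id.sub continuous_const).tendsto s
      rw [sub_self] at this
      exact this.mono_left nhdsWithin_le_nhds
    have := hl.mul_isBigO (Asymptotics.isBigO_refl (fun t : ℝ => t - s) (nhdsWithin s (Ici s)))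
    simpa [sq] using this) t ht
  rw [Matrix.mem_unitaryGroup_iff']
  change (U t)ᴴ * U t = 1
  rw [hconst, propagator_zero (ht.1.trans ht.2) hU]
  simp

/-- The chord from the identity to the propagator is at most that of a geodesic of the same
length. -/
theorem norm_propagator_sub_one_sq_le (hT : 0 ≤ T) (hV : IntegrableOn V (Icc 0 T))
    (hh : ∀ t ∈ Icc 0 T, (V t).IsHermitian) (hU : IsTimeOrderedExp V U T)
    (hv : ∀ t ∈ Icc 0 T, ‖V t‖ ≤ v) (hvT : v * T ≤ Real.pi) :
    ‖U T - 1‖ ^ 2 ≤ 2 - 2 * Real.cos (v * T) := by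
  have hun : ∀ t ∈ Icc 0 T, U t ∈ Matrix.unitaryGroup n ℂ := fun t ht =>
    propagator_mem_unitaryGroup hV hh hU hv ht
  have hc : 0 ≤ 2 - 2 * Real.cos (v * T) := by linarith [Real.cos_le_one (v * T)]
  set φ := Matrix.toEuclideanCLM (n := n) (𝕜 := ℂ) with hφ
  have key : ∀ x : EuclideanSpace ℂ n, ‖x‖ = 1 →
      ‖φ (U T - 1) x‖ ≤ √(2 - 2 * Real.cos (v * T)) := by
    intro x hx
    have hn : ∀ t ∈ Icc 0 T, ‖φ (U t) x‖ = 1 := by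
      intro t ht
      have h := norm_toEuclideanCLM_apply_sq (U t) x
      have hUU : (U t)ᴴ * U t = 1 := Matrix.mem_unitaryGroup_iff'.mp (hun t ht)
      rw [hUU, map_one, one_apply_eq_self, inner_self_eq_norm_sq_to_K, hx] at h
      have h' : ‖φ (U t) x‖ ^ 2 = 1 := by rw [h]; simp
      exact (pow_eq_one_iff_of_nonneg (norm_nonneg _) two_ne_zero).mp h'
    have hlip : ∀ s ∈ Icc 0 T, ∀ t ∈ Icc 0 T, s ≤ t →
        ‖φ (U s) x - φ (U t) x‖ ≤ v * (t - s) := by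
      intro s hs t ht hst
      rw [norm_sub_rev, ← sub_apply, ← map_sub]
      calc ‖φ (U t - U s) x‖ ≤ ‖φ (U t - U s)‖ * ‖x‖ := ContinuousLinearMap.le_opNorm _ _
        _ = ‖U t - U s‖ := by rw [hx, mul_one, Matrix.cstar_norm_def]
        _ ≤ v * 1 * (t - s) := norm_propagator_sub_le hV hU hv
          (fun r hr => norm_unitary_le_one (hun r hr)) hs ht hst
        _ = v * (t - s) := by rw [mul_one]
    -- Angles are taken for the real part of the complex inner product.
    let _ : InnerProductSpace ℝ (EuclideanSpace ℂ n) := InnerProductSpace.rclikeToReal ℂ _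
    have hang := angle_le_of_lipschitz (x := fun t => φ (U t) x) hT hn hlip
    have h0 : (0 : ℝ) ∈ Icc 0 T := ⟨le_rfl, hT⟩
    have hsq := norm_sub_sq_eq_cos_angle (hn 0 h0) (hn T ⟨hT, le_rfl⟩)
    have hcos := Real.cos_le_cos_of_nonneg_of_le_pi
      (InnerProductGeometry.angle_nonneg _ _) hvT hang
    apply Real.le_sqrt_of_sq_le
    rw [propagator_zero hT hU, norm_sub_rev, ← sub_apply, ← map_sub] at hsq
    rw [hsq]
    rw [propagator_zero hT hU] at hcos
    linarith
  have hle : ‖U T - 1‖ ≤ √(2 - 2 * Real.cos (v * T)) := by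
    rw [Matrix.cstar_norm_def]
    refine ContinuousLinearMap.opNorm_le_of_unit_norm (Real.sqrt_nonneg _) key
  calc ‖U T - 1‖ ^ 2 ≤ √(2 - 2 * Real.cos (v * T)) ^ 2 := by gcongr
    _ = _ := Real.sq_sqrt hc

end QuantumCharging

namespace QuantumCharging

variable {n : Type*} [Fintype n] [DecidableEq n]

/-! ### Logarithms of unitary matrices -/

theorem abs_arg_le_of_cos_le_re {z : ℂ} (hz : ‖z‖ = 1) {r : ℝ} (hr : 0 ≤ r)
    (h : Real.cos r ≤ z.re) : |z.arg| ≤ r := by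
  by_contra! hlt
  have hne : z ≠ 0 := by
    rintro rfl
    simp at hz
  have h1 := Real.cos_lt_cos_of_nonneg_of_le_pi hr (Complex.abs_arg_le_pi z) hlt
  rw [Real.cos_abs, Complex.cos_arg hne, hz, div_one] at h1
  linarith

/-- `K` is the principal logarithm, with eigenvalues `-arg z`. The chord bound forces `Re z ≥ cos r`
on the spectrum; for `r > π` no chord bound is needed, as `|arg z| ≤ π`. -/
theorem exists_isHermitian_exp_eq {W : Matrix n n ℂ} (hW : W ∈ Matrix.unitaryGroup n ℂ) :
    ∃ K : Matrix n n ℂ, K.IsHermitian ∧ NormedSpace.exp (-Complex.I • K) = W ∧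
      ∀ r : ℝ, 0 ≤ r → (r ≤ Real.pi → ‖W - 1‖ ^ 2 ≤ 2 - 2 * Real.cos r) → ‖K‖ ≤ r := by
  have hWu : W ∈ unitary (Matrix n n ℂ) := hW
  have hnormal : IsStarNormal W := ⟨by
    rw [commute_iff_eq, Unitary.star_mul_self_of_mem hWu, Unitary.mul_star_self_of_mem hWu]⟩
  have hc : ∀ f : ℂ → ℂ, ContinuousOn f (spectrum ℂ W) := fun f =>
    (Matrix.finite_spectrum W).continuousOn f
  let g : ℂ → ℂ := fun z => ((-z.arg : ℝ) : ℂ)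
  refine ⟨cfc g W, ?_, ?_, ?_⟩
  · change star (cfc g W) = cfc g W
    rw [← cfc_star]
    congr 1
    ext z
    simp [g]
  · have hI : -Complex.I • cfc g W = cfc (fun z => -Complex.I • g z) W :=
      (cfc_smul (-Complex.I) g W (hc g)).symm
    have hN : IsStarNormal (cfc (fun z => -Complex.I • g z) W) := cfc_predicate _ W
    rw [hI, ← CFC.exp_eq_normedSpace_exp (𝕜 := ℂ) hN,
      ← cfc_comp' NormedSpace.exp (fun z => -Complex.I • g z) W
        ((Set.Finite.image _ (Matrix.finite_spectrum W)).continuousOn _) (hc _)]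
    conv_rhs => rw [← cfc_id ℂ W]
    refine cfc_congr fun z hz => ?_
    have hz1 : ‖z‖ = 1 := spectrum.norm_eq_one_of_unitary hWu hz
    have := Complex.norm_mul_exp_arg_mul_I z
    rw [hz1, Complex.ofReal_one, one_mul] at this
    simp only [g, ← Complex.exp_eq_exp_ℂ, id]
    conv_rhs => rw [← this]
    congr 1
    push_cast
    rw [smul_eq_mul]
    ring
  · intro r hr h
    refine norm_cfc_le hr fun z hz => ?_
    simp only [g, Complex.norm_real, norm_neg, Real.norm_eq_abs]
    by_cases hpi : r ≤ Real.pi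
    · refine abs_arg_le_of_cos_le_re (spectrum.norm_eq_one_of_unitary hWu hz) hr ?_
      have := Unitary.two_mul_one_sub_le_norm_sub_one_sq hWu hz
      linarith [h hpi]
    · exact (Complex.abs_arg_le_pi z).trans (not_le.mp hpi).le

theorem exp_neg_I_smul_mem_unitaryGroup {K : Matrix n n ℂ} (hK : K.IsHermitian) :
    NormedSpace.exp (-Complex.I • K) ∈ Matrix.unitaryGroup n ℂ := by
  have h := (selfAdjoint.expUnitary (⟨-K, hK.neg⟩ : selfAdjoint (Matrix n n ℂ))).2
  rw [selfAdjoint.expUnitary_coe] at h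
  simpa using h

/-! ### Constant Hamiltonians -/

theorem isTimeOrderedExp_const (A : Matrix n n ℂ) (T : ℝ) :
    IsTimeOrderedExp (fun _ => A) (fun t => NormedSpace.exp (t • (-Complex.I • A))) T := by
  set X := -Complex.I • A with hX
  have hd : ∀ t : ℝ, HasDerivAt (fun u : ℝ => NormedSpace.exp (u • X))
      (X * NormedSpace.exp (t • X)) t := fun t => hasDerivAt_exp_smul_const' X t
  have hcont : Continuous fun t : ℝ => NormedSpace.exp (t • X) :=
    continuous_iff_continuousAt.mpr fun t => (hd t).continuousAt
  refine ⟨hcont.continuousOn, fun t _ => ?_⟩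
  have h := intervalIntegral.integral_eq_sub_of_hasDerivAt (a := 0) (b := t) (fun s _ => hd s)
    ((continuous_const.mul hcont).intervalIntegrable _ _)
  have hI : ∀ s : ℝ, X * NormedSpace.exp (s • X) = -Complex.I • (A * NormedSpace.exp (s • X)) := by
    intro s
    conv_lhs => rw [hX, Matrix.smul_mul]
  simp only [hI, intervalIntegral.integral_smul, zero_smul, NormedSpace.exp_zero] at h
  rw [neg_smul] at h
  rw [sub_eq_add_neg, h]
  abel

theorem drives_const {A : Matrix n n ℂ} (hA : A.IsHermitian) {T : ℝ} (hT : 0 ≤ T)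
    {ρ σ : Matrix n n ℂ}
    (h : NormedSpace.exp (-Complex.I • (T • A)) * ρ * (NormedSpace.exp (-Complex.I • (T • A)))ᴴ = σ) :
    Drives (fun _ => A) T ρ σ where
  time_nonneg := hT
  integrable := continuousOn_const.integrableOn_compact isCompact_Icc
  hermitian := fun _ _ => hA
  reaches := ⟨_, isTimeOrderedExp_const A T, by
    rw [smul_comm T (-Complex.I) A]
    exact h⟩

/-! ### The charging distance as a minimum over logarithms -/

/-- The Hermitian generators `K` for which `exp (-i K)` takes `ρ` to `σ`. -/
def generators (ρ σ : Matrix n n ℂ) : Set (Matrix n n ℂ) :=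
  {K | K.IsHermitian ∧
    NormedSpace.exp (-Complex.I • K) * ρ * (NormedSpace.exp (-Complex.I • K))ᴴ = σ}

theorem isClosed_generators (ρ σ : Matrix n n ℂ) : IsClosed (generators ρ σ) := by
  let _ : NormedAlgebra ℚ (Matrix n n ℂ) := NormedAlgebra.restrictScalars ℚ ℂ _
  have he : Continuous fun K : Matrix n n ℂ => NormedSpace.exp (-Complex.I • K) :=
    NormedSpace.exp_continuous.comp (continuous_const_smul _)
  refine IsClosed.inter ?_ ?_
  · exact isClosed_eq continuous_star continuous_id
  · exact isClosed_eq ((he.mul continuous_const).mul he.star) continuous_const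

theorem exists_unitary_conj_eq {ρ σ : Matrix n n ℂ} (hρ : ρ.IsHermitian) (hσ : σ.IsHermitian)
    (hspec : ρ.charpoly = σ.charpoly) :
    ∃ W ∈ Matrix.unitaryGroup n ℂ, W * ρ * Wᴴ = σ := by
  have hev := (hρ.eigenvalues_eq_eigenvalues_iff hσ).mpr hspec
  have h1 := hρ.spectral_theorem
  have h2 := hσ.spectral_theorem
  rw [← hev] at h2
  generalize Matrix.diagonal ((RCLike.ofReal : ℝ → ℂ) ∘ hρ.eigenvalues) = d at h1 h2
  generalize hρ.eigenvectorUnitary = P at h1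
  generalize hσ.eigenvectorUnitary = Q at h2
  -- Both states have the same diagonal form `d`: undo the eigenbasis of `ρ`, then apply that of
  -- `σ`.
  refine ⟨(Q * star P : Matrix.unitaryGroup n ℂ), (Q * star P).2, ?_⟩
  have h3 : ((Unitary.conjStarAlgAut ℂ (Matrix n n ℂ)) (Q * star P)) ρ = σ := by
    rw [h2, h1, ← Unitary.conjStarAlgAut_mul_apply, mul_assoc, Unitary.star_mul_self, mul_one]
  rw [← h3, Unitary.conjStarAlgAut_apply]
  rfl

theorem generators_nonempty {ρ σ : Matrix n n ℂ} (hρ : ρ.IsHermitian) (hσ : σ.IsHermitian)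
    (hspec : ρ.charpoly = σ.charpoly) : (generators ρ σ).Nonempty := by
  obtain ⟨W, hW, h⟩ := exists_unitary_conj_eq hρ hσ hspec
  obtain ⟨K, hK, hKW, -⟩ := exists_isHermitian_exp_eq hW
  exact ⟨K, hK, by rw [hKW, h]⟩

/-- A time-dependent drive is no faster than the best constant one. -/
theorem Drives.exists_generator {ρ σ : Matrix n n ℂ} {V : ℝ → Matrix n n ℂ} {T v : ℝ}
    (h : Drives V T ρ σ) (hv : ∀ t ∈ Icc 0 T, ‖V t‖ ≤ v) :
    ∃ K ∈ generators ρ σ, ‖K‖ ≤ v * T := by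
  obtain ⟨U, hU, hUσ⟩ := h.reaches
  have hT := h.time_nonneg
  have hv0 : 0 ≤ v := (norm_nonneg _).trans (hv 0 ⟨le_rfl, hT⟩)
  obtain ⟨K, hK, hKU, hKn⟩ := exists_isHermitian_exp_eq
    (propagator_mem_unitaryGroup h.integrable h.hermitian hU hv ⟨hT, le_rfl⟩)
  exact ⟨K, ⟨hK, by rw [hKU, hUσ]⟩, hKn _ (mul_nonneg hv0 hT) fun hpi =>
    norm_propagator_sub_one_sq_le hT h.integrable h.hermitian hU hv hpi⟩

theorem ne_zero_of_mem_generators {ρ σ K : Matrix n n ℂ} (hne : ρ ≠ σ)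
    (hK : K ∈ generators ρ σ) : K ≠ 0 := by
  rintro rfl
  apply hne
  simpa using hK.2

/-- A generator drives `ρ` to `σ` at any prescribed operator norm `v`. -/
theorem drives_of_mem_generators {ρ σ K : Matrix n n ℂ} (hne : ρ ≠ σ) (hK : K ∈ generators ρ σ)
    {v : ℝ} (hv : 0 < v) :
    Drives (fun _ => (v / ‖K‖) • K) (‖K‖ / v) ρ σ ∧ ‖(v / ‖K‖) • K‖ = v := by
  have hK0 : 0 < ‖K‖ := norm_pos_iff.mpr (ne_zero_of_mem_generators hne hK)
  constructor
  · refine drives_const ?_ (by positivity) ?_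
    · change star _ = _
      rw [star_smul, show star K = K from hK.1, star_trivial]
    · rw [smul_smul, show ‖K‖ / v * (v / ‖K‖) = 1 by field_simp, one_smul]
      exact hK.2
  · rw [norm_smul, Real.norm_of_nonneg (by positivity)]
    field_simp

/-- A nonempty closed set in a proper space has a point nearest to `0`. Rescaled to norm one, this
generator is itself an optimal drive, so the infimum of times is attained. -/
theorem exists_generator_norm_eq_chargingDistance {ρ σ : Matrix n n ℂ} (hρ : ρ.IsHermitian)
    (hσ : σ.IsHermitian) (hspec : ρ.charpoly = σ.charpoly) (hne : ρ ≠ σ) :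
    ∃ K ∈ generators ρ σ, ‖K‖ = chargingDistance ρ σ ∧ ∀ L ∈ generators ρ σ, ‖K‖ ≤ ‖L‖ := by
  have : ProperSpace (Matrix n n ℂ) := FiniteDimensional.proper ℂ _
  obtain ⟨K, hK, hKd⟩ := (isClosed_generators ρ σ).exists_infDist_eq_dist
    (generators_nonempty hρ hσ hspec) 0
  have hmin : ∀ L ∈ generators ρ σ, ‖K‖ ≤ ‖L‖ := by
    intro L hL
    have := Metric.infDist_le_dist_of_mem (x := 0) hL
    rwa [hKd, dist_zero_left, dist_zero_left] at this
  refine ⟨K, hK, ?_, hmin⟩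
  have hd := drives_of_mem_generators hne hK one_pos
  rw [div_one] at hd
  have hmem : ‖K‖ ∈ {T : ℝ | ∃ V : ℝ → Matrix n n ℂ,
      Drives V T ρ σ ∧ ∀ t ∈ Icc 0 T, ‖V t‖ = 1} := ⟨_, hd.1, fun _ _ => hd.2⟩
  refine (IsLeast.csInf_eq ⟨hmem, ?_⟩).symm
  rintro T ⟨V, hV, hVn⟩
  obtain ⟨L, hL, hLn⟩ := hV.exists_generator fun t ht => (hVn t ht).le
  linarith [hmin L hL]

/-- The fidelity bound for the time needed by a generator. -/
theorem arccos_fidelity_le_norm {ρ σ K : Matrix n n ℂ} (hρ : IsDensityMatrix ρ)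
    (hK : K ∈ generators ρ σ) : Real.arccos (fidelity ρ σ) ≤ ‖K‖ := by
  by_cases hpi : ‖K‖ ≤ Real.pi
  swap
  · exact (Real.arccos_le_pi _).trans (not_le.mp hpi).le
  set W := NormedSpace.exp (-Complex.I • K) with hW
  have hWu : W ∈ Matrix.unitaryGroup n ℂ := exp_neg_I_smul_mem_unitaryGroup hK.1
  have hF := re_trace_mul_le_fidelity hρ.1 hWu
  rw [hK.2] at hF
  have hdr : IsTimeOrderedExp (fun _ => K) _ 1 := isTimeOrderedExp_const K 1
  have hchord := norm_propagator_sub_one_sq_le (v := ‖K‖) zero_le_one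
    (continuousOn_const.integrableOn_compact isCompact_Icc) (fun _ _ => hK.1) hdr
    (fun _ _ => le_rfl) (by rwa [mul_one])
  rw [one_smul, mul_one, ← hW] at hchord
  have h1 : Wᴴ * W = 1 := Matrix.mem_unitaryGroup_iff'.mp hWu
  -- Averaging `(W - 1)ᴴ (W - 1) = 2 - W - Wᴴ` in the state `ρ` gives `2 - 2 Re tr (W ρ) ≤ ‖W - 1‖ ^
  -- 2 ≤ 2 - 2 cos ‖K‖`.
  have htr := re_trace_mul_le_norm_mul_trace ((W - 1)ᴴ * (W - 1)) hρ.1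
  have hexp : (W - 1)ᴴ * (W - 1) * ρ = ρ + ρ - W * ρ - Wᴴ * ρ := by
    rw [Matrix.conjTranspose_sub, sub_mul, mul_sub, h1, Matrix.conjTranspose_one]
    noncomm_ring
  have hconj : (Wᴴ * ρ).trace.re = (W * ρ).trace.re := by
    have : Wᴴ * ρ = (ρ * W)ᴴ := by rw [Matrix.conjTranspose_mul, hρ.1.1.eq]
    rw [this, Matrix.trace_conjTranspose, Matrix.trace_mul_comm]
    simp
  rw [Matrix.l2_opNorm_conjTranspose_mul_self, hexp, Matrix.trace_sub, Matrix.trace_sub,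
    Matrix.trace_add, hρ.2, Complex.sub_re, Complex.sub_re, hconj] at htr
  simp only [Complex.add_re, Complex.one_re] at htr
  have hcos : Real.cos ‖K‖ ≤ fidelity ρ σ := by nlinarith
  calc Real.arccos (fidelity ρ σ) ≤ Real.arccos (Real.cos ‖K‖) := Real.arccos_le_arccos hcos
    _ = ‖K‖ := Real.arccos_cos (norm_nonneg _) hpi

end QuantumCharging

/-! ### The power bound, its attainment and the ratio of distances -/

theorem mainTheorem8 {n : Type*} [Fintype n] [DecidableEq n] (ρ σ : Matrix n n ℂ)
    (hρ : QuantumCharging.IsDensityMatrix ρ) (hσ : QuantumCharging.IsDensityMatrix σ)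
    (hspec : ρ.charpoly = σ.charpoly) (hne : ρ ≠ σ) :
    0 < QuantumCharging.chargingDistance ρ σ ∧
    -- the bound on the mean power, and its comparison with the bound `2 ‖H‖ ‖V‖`
    (∀ (H : Matrix n n ℂ) (V : ℝ → Matrix n n ℂ) (T v : ℝ), H.IsHermitian →
      QuantumCharging.Drives V T ρ σ → (∀ t ∈ Set.Icc 0 T, ‖V t‖ ≤ v) →
        0 < T ∧
        QuantumCharging.meanPower H ρ σ T ≤
          2 * ‖H‖ * v *
            (QuantumCharging.traceDistance ρ σ / QuantumCharging.chargingDistance ρ σ) ∧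
        2 * ‖H‖ * v *
            (QuantumCharging.traceDistance ρ σ / QuantumCharging.chargingDistance ρ σ) ≤
          2 * ‖H‖ * v) ∧
    -- the bound is attained for all prescribed operator norms of `H` and `V`
    (∀ h v : ℝ, 0 ≤ h → 0 < v →
      ∃ (H : Matrix n n ℂ) (V : ℝ → Matrix n n ℂ) (T : ℝ), H.IsHermitian ∧ ‖H‖ = h ∧
        QuantumCharging.Drives V T ρ σ ∧ (∀ t ∈ Set.Icc 0 T, ‖V t‖ = v) ∧
        QuantumCharging.meanPower H ρ σ T =
          2 * h * v *
            (QuantumCharging.traceDistance ρ σ / QuantumCharging.chargingDistance ρ σ)) ∧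
    -- the ratio of the distances
    0 < Real.arccos (QuantumCharging.fidelity ρ σ) ∧
    QuantumCharging.traceDistance ρ σ / QuantumCharging.chargingDistance ρ σ ≤
      √(1 - QuantumCharging.fidelity ρ σ ^ 2) / Real.arccos (QuantumCharging.fidelity ρ σ) ∧
    √(1 - QuantumCharging.fidelity ρ σ ^ 2) / Real.arccos (QuantumCharging.fidelity ρ σ) < 1 := by
  have hn : Nonempty n := by
    by_contra hn
    rw [not_nonempty_iff] at hn
    have h := hρ.2
    simp [Matrix.trace] at h
  obtain ⟨K, hK, hKd, hmin⟩ :=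
    QuantumCharging.exists_generator_norm_eq_chargingDistance hρ.1.1 hσ.1.1 hspec hne
  have hD : 0 < QuantumCharging.chargingDistance ρ σ :=
    hKd ▸ norm_pos_iff.mpr (QuantumCharging.ne_zero_of_mem_generators hne hK)
  have hF1 := QuantumCharging.fidelity_lt_one hρ hσ hne
  have hF0 := QuantumCharging.fidelity_nonneg ρ σ
  have harc : 0 < Real.arccos (QuantumCharging.fidelity ρ σ) := Real.arccos_pos.mpr hF1
  have hratio : QuantumCharging.traceDistance ρ σ / QuantumCharging.chargingDistance ρ σ ≤
      √(1 - QuantumCharging.fidelity ρ σ ^ 2) / Real.arccos (QuantumCharging.fidelity ρ σ) :=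
    div_le_div₀ (Real.sqrt_nonneg _) (QuantumCharging.traceDistance_le_sqrt hρ hσ) harc
      (hKd ▸ QuantumCharging.arccos_fidelity_le_norm hρ hK)
  have hlt : √(1 - QuantumCharging.fidelity ρ σ ^ 2) /
      Real.arccos (QuantumCharging.fidelity ρ σ) < 1 := by
    rw [div_lt_one harc, ← Real.sin_arccos]
    exact Real.sin_lt harc
  have hDtr := QuantumCharging.traceDistance_nonneg ρ σ
  refine ⟨hD, ?_, ?_, harc, hratio, hlt⟩
  · intro H V T v _ hV hv
    obtain ⟨L, hL, hLn⟩ := hV.exists_generator hv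
    have hT0 := hV.time_nonneg
    have hv0 : 0 ≤ v := (norm_nonneg _).trans (hv 0 ⟨le_rfl, hT0⟩)
    have hDT : QuantumCharging.chargingDistance ρ σ ≤ v * T := hKd ▸ (hmin L hL).trans hLn
    have hT : 0 < T := by
      rcases hT0.eq_or_lt with h | h
      · rw [← h, mul_zero] at hDT
        exact absurd hDT (not_le.mpr hD)
      · exact h
    refine ⟨hT, ?_, ?_⟩
    · rw [QuantumCharging.meanPower, div_le_iff₀ hT]
      calc |QuantumCharging.expectation H ρ - QuantumCharging.expectation H σ|
          ≤ 2 * ‖H‖ * QuantumCharging.traceDistance ρ σ :=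
            QuantumCharging.abs_expectation_sub_le H ρ σ
        _ = 2 * ‖H‖ * (QuantumCharging.traceDistance ρ σ /
              QuantumCharging.chargingDistance ρ σ) * QuantumCharging.chargingDistance ρ σ := by
            field_simp
        _ ≤ 2 * ‖H‖ * (QuantumCharging.traceDistance ρ σ /
              QuantumCharging.chargingDistance ρ σ) * (v * T) := by gcongr
        _ = _ := by ring
    · exact mul_le_of_le_one_right (by positivity) (hratio.trans hlt.le)
  · intro h v hh hv
    obtain ⟨S, hS, hS1, hSe⟩ := QuantumCharging.exists_expectation_sub_eq hρ.1.1 hσ.1.1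
    obtain ⟨hdr, hnorm⟩ := QuantumCharging.drives_of_mem_generators hne hK hv
    -- The drive is the constant `(v / ‖K‖) • K` for time `‖K‖ / v`, with `‖K‖` the charging
    -- distance.
    refine ⟨h • S, _, _, ?_, ?_, hdr, fun _ _ => hnorm, ?_⟩
    · change star _ = _
      rw [star_smul, show star S = S from hS, star_trivial]
    · rw [norm_smul, hS1, mul_one, Real.norm_of_nonneg hh]
    · have he : QuantumCharging.expectation (h • S) ρ - QuantumCharging.expectation (h • S) σ =
          h * (2 * QuantumCharging.traceDistance ρ σ) := by
        rw [← hSe]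
        simp [QuantumCharging.expectation, mul_sub]
      rw [QuantumCharging.meanPower, he, abs_of_nonneg (by positivity), hKd]
      field_simp
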